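/- Let $\mathbf I$ be a finite oriented graph drawn in the plane $\mathbb C$ without crossings (links are polygonal arcs that meet only at their ends), such that at every vertex the number of incoming links equals the number of outgoing links, and let $C$ (the central face) be a face of $\mathbf I$, i.e. a connected component of the complement of the drawing. *Winding number.* For a semi-infinite polygonal line $L$ that starts in $C$ and crosses $\mathbf I$ transversally at interior points of links (it avoids the vertices and the corners of the links, and no corner of $L$ lies on $\mathbf I$), let $\mathcal W(L)\in\mathbb Z$ be the number of crossings counted with sign: $+1$ when the link crosses the outgoing line anticlockwise (from right to left), $-1$ otherwise. *Dynamics.* At each vertex $v$ let a unitary matrix $S_v$, with columns indexed by the incoming and rows by the outgoing links of $v$, be given (the scattering amplitudes). Let $\mathcal U$ be the operator on the space spanned by the links with $\langle e'|\mathcal U|e\rangle=(S_v)_{e'e}$ if $e$ points towards $v$ and $e'$ leaves $v$, and $\langle e'|\mathcal U|e\rangle=0$ if $e'$ does not leave the vertex that $e$ points towards. *Section and flow.* A cross section $\sigma$ is a simple polygonal line from $C$ to the exterior (unbounded) face that meets $\mathbf I$ in vertices only. Let $R\subseteq\mathbb C$ be a region on the anticlockwise side of $\sigma$: every link (without its ends)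 lies inside $R$ or is disjoint from $R$, and near each vertex crossed by $\sigma$, $R$ contains the directions to the left of $\sigma$ (followed outwards) and not those to its right; away from $\sigma$, $R$ is arbitrary. Let $\mathcal P$ be the projector on the links inside $R$. Let $\mathcal Q$ be the projector on a set of links that contains all links pointing towards a vertex of $\sigma$, and no link pointing towards any other vertex at which links inside $R$ and links outside $R$ meet. The flow is $$\Phi=\operatorname{tr}\left(\mathcal Q\,\mathcal U^{-1}\mathcal P\,\mathcal U\,\mathcal Q-\mathcal Q\mathcal P\mathcal Q\right).$$ **Claim.** There is an integer $\mathcal W$, depending only on the drawing of $\mathbf I$ and on $C$, such that lines $L$ as above exist, $\mathcal W(L)=\mathcal W$ for every such $L$, and $$\Phi=\mathcal W$$ for every choice of the unitary scattering matrices $S_v$, of the section $\sigma$, of the region $R$ and of the set of links defining $\mathcal Q$. In particular $\Phi$ is an integer, independent of the scattering amplitudes and of the section. -/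

import Mathlib

open Set Filter Topology

noncomputable section

/-- The wedge product of two vectors of the oriented plane `ℂ`; it is positive when `w` points
to the left (anticlockwise side) of `u`. -/
def wedge (u w : ℂ) : ℝ := u.re * w.im - u.im * w.re

/-- The angle in `[0, 2π)` by which `f` has to be turned anticlockwise to point along `d`. -/
def ccwAngle (f d : ℂ) : ℝ := toIcoMod Real.two_pi_pos 0 (Complex.arg (d / f))

/-- A line passes through a point, coming from direction `b` (the vector from the point back to
where the line comes from) and leaving in direction `f`. The direction `d` is to the left of it. -/
def IsLeftOf (b f d : ℂ) : Prop := 0 < ccwAngle f d ∧ ccwAngle f d < ccwAngle f b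

/-- As for `IsLeftOf`, with `d` to the right of the line. -/
def IsRightOf (b f d : ℂ) : Prop := ccwAngle f b < ccwAngle f d

/-- The half-line from `p` in direction `u`. -/
def halfLine (p u : ℂ) : Set ℂ := {z | ∃ t : ℝ, 0 ≤ t ∧ z = p + (t : ℂ) * u}

open Classical in
/-- The sign of the crossing of a straight piece `A` of a line, running in direction `u`, by the
straight oriented piece from `a` to `b` of a link: `+1` if the link crosses from the right of the
line to its left, `-1` if from left to right, `0` if they do not meet. -/
def crossingSign (A : Set ℂ) (u a b : ℂ) : ℤ :=
  if (A ∩ segment ℝ a b).Nonempty then (SignType.sign (wedge u (b - a)) : ℤ) else 0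

/-- An oriented plane graph with vertices `V` and links `E`, with as many links pointing towards
each vertex as away from it. The link `e` is drawn in the plane `ℂ` as the polygonal arc with
successive corners `corner e 0, …, corner e (size e)`; the values of `corner e` after `size e`
are irrelevant. -/
structure PlaneEulerianGraph (V E : Type*) [Fintype E] [DecidableEq V] where
  src : E → V
  tgt : E → V
  balanced : ∀ v, Fintype.card {e // tgt e = v} = Fintype.card {e // src e = v}
  pos : V → ℂ
  pos_injective : Function.Injective pos
  size : E → ℕ
  size_pos : ∀ e, 0 < size e
  corner : E → ℕ → ℂ
  corner_zero : ∀ e, corner e 0 = pos (src e)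
  corner_size : ∀ e, corner e (size e) = pos (tgt e)
  /-- No point of a link, apart from its two ends, is a vertex. -/
  ne_pos : ∀ e, ∀ i < size e, ∀ s ∈ Ico (0 : ℝ) 1, (0 < i ∨ 0 < s) →
    ∀ v, AffineMap.lineMap (corner e i) (corner e (i + 1)) s ≠ pos v
  /-- A link does not meet itself or another link, apart from the ends of links. -/
  planar : ∀ e e' i i', i < size e → i' < size e' →
    ∀ s ∈ Ico (0 : ℝ) 1, ∀ s' ∈ Ico (0 : ℝ) 1, (0 < i ∨ 0 < s) →
    AffineMap.lineMap (corner e i) (corner e (i + 1)) s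
      = (AffineMap.lineMap (corner e' i') (corner e' (i' + 1)) s' : ℂ) →
    e = e' ∧ i = i' ∧ s = s'

namespace PlaneEulerianGraph

variable {V E : Type*} [Fintype E] [DecidableEq V]

/-- The set of points of the plane that lie on the graph. -/
def support (G : PlaneEulerianGraph V E) : Set ℂ :=
  range G.pos ∪ ⋃ e, ⋃ i, ⋃ _ : i < G.size e, segment ℝ (G.corner e i) (G.corner e (i + 1))

/-- The points of a link, apart from its two ends. -/
def linkInterior (G : PlaneEulerianGraph V E) (e : E) : Set ℂ :=
  {z | ∃ i < G.size e, ∃ s ∈ Ico (0 : ℝ) 1, (0 < i ∨ 0 < s) ∧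
    z = AffineMap.lineMap (G.corner e i) (G.corner e (i + 1)) s}

/-- The faces are the connected components of the complement of the graph. -/
def IsFace (G : PlaneEulerianGraph V E) (C : Set ℂ) : Prop :=
  ∃ z ∈ G.supportᶜ, C = connectedComponentIn G.supportᶜ z

/-- The exterior face: the points whose component in the complement of the graph is unbounded. -/
def exterior (G : PlaneEulerianGraph V E) : Set ℂ :=
  {z | ¬ Bornology.IsBounded (connectedComponentIn G.supportᶜ z)}

/-! ### Winding number -/

/-- A semi-infinite polygonal line which starts in `C` and is in general position with respect to
the graph: it avoids the vertices and the corners of the links, and its own corners are not on the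
graph, so that it meets the links in finitely many transverse crossings. It consists of the
segments between the successive points `pt 0, …, pt size` and of the half-line from `pt size` in
direction `dir`. -/
structure TransverseLine (G : PlaneEulerianGraph V E) (C : Set ℂ) where
  size : ℕ
  pt : ℕ → ℂ
  dir : ℂ
  dir_ne_zero : dir ≠ 0
  start_mem : pt 0 ∈ C
  pt_notMem : ∀ j ≤ size, pt j ∉ G.support
  pos_notMem : ∀ v, (∀ j < size, G.pos v ∉ segment ℝ (pt j) (pt (j + 1))) ∧
    G.pos v ∉ halfLine (pt size) dir
  corner_notMem : ∀ e, ∀ i ≤ G.size e,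
    (∀ j < size, G.corner e i ∉ segment ℝ (pt j) (pt (j + 1))) ∧
      G.corner e i ∉ halfLine (pt size) dir

/-- The algebraic number of crossings of the oriented links with the line; a link that crosses
the (outgoing) line anticlockwise, i.e. from right to left, counts `+1`. -/
def crossingNumber (G : PlaneEulerianGraph V E) {C : Set ℂ} (L : G.TransverseLine C) : ℤ :=
  ∑ e, ∑ i ∈ Finset.range (G.size e),
    ((∑ j ∈ Finset.range L.size,
        crossingSign (segment ℝ (L.pt j) (L.pt (j + 1))) (L.pt (j + 1) - L.pt j)
          (G.corner e i) (G.corner e (i + 1)))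
      + crossingSign (halfLine (L.pt L.size) L.dir) L.dir (G.corner e i) (G.corner e (i + 1)))

/-- `W` is the winding number of the graph around `C`: transverse semi-infinite lines starting in
`C` exist, and all of them have algebraic crossing number `W`. -/
def IsWindingNumber (G : PlaneEulerianGraph V E) (C : Set ℂ) (W : ℤ) : Prop :=
  Nonempty (G.TransverseLine C) ∧ ∀ L : G.TransverseLine C, G.crossingNumber L = W

/-! ### Coherent dynamics -/

/-- A unitary scattering matrix at every vertex, from the incoming to the outgoing links. -/
structure Scattering [DecidableEq E] (G : PlaneEulerianGraph V E) where
  amp : ∀ v, Matrix {e // G.src e = v} {e // G.tgt e = v} ℂ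
  conjTranspose_mul : ∀ v, (amp v).conjTranspose * amp v = 1
  mul_conjTranspose : ∀ v, amp v * (amp v).conjTranspose = 1

/-- The step-evolution operator on the space of states spanned by the links. -/
def Scattering.evolution [DecidableEq E] {G : PlaneEulerianGraph V E} (S : G.Scattering) : Matrix E E ℂ :=
  fun e' e => if h : G.src e' = G.tgt e then S.amp (G.tgt e) ⟨e', h⟩ ⟨e, rfl⟩ else 0

open Classical in
/-- The projector on the span of the links in `A`. -/
def projector [DecidableEq E] (A : Set E) : Matrix E E ℂ :=
  Matrix.diagonal fun e => if e ∈ A then 1 else 0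

/-- The flow operator `Q U⁻¹ P U Q - Q P Q`. -/
def Scattering.flowOperator [DecidableEq E] {G : PlaneEulerianGraph V E} (S : G.Scattering)
    (P Q : Set E) : Matrix E E ℂ :=
  projector Q * S.evolution⁻¹ * projector P * S.evolution * projector Q
    - projector Q * projector P * projector Q

/-- The flow: the trace of the flow operator. -/
def Scattering.flow [DecidableEq E] {G : PlaneEulerianGraph V E} (S : G.Scattering)
    (P Q : Set E) : ℂ :=
  (S.flowOperator P Q).trace

/-- A cross section: a simple polygonal line `pt 0, …, pt size` from `C` to the exterior face
which meets the graph at vertices only. The vertices which it crosses are taken to be listed among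
the points `pt i` (which need not be actual corners of the line). -/
structure CrossSection (G : PlaneEulerianGraph V E) (C : Set ℂ) where
  size : ℕ
  pt : ℕ → ℂ
  start_mem : pt 0 ∈ C
  end_mem : pt size ∈ G.exterior
  simple : ∀ i < size, ∀ j < size, ∀ s ∈ Icc (0 : ℝ) 1, ∀ t ∈ Icc (0 : ℝ) 1,
    AffineMap.lineMap (pt i) (pt (i + 1)) s = (AffineMap.lineMap (pt j) (pt (j + 1)) t : ℂ) →
    (i : ℝ) + s = j + t
  avoids_links : ∀ i < size, ∀ s ∈ Ioo (0 : ℝ) 1,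
    AffineMap.lineMap (pt i) (pt (i + 1)) s ∉ G.support
  crosses_vertices : ∀ i ≤ size, pt i ∈ G.support → pt i ∈ range G.pos

/-- The vertices crossed by the section. -/
def CrossSection.vertices {G : PlaneEulerianGraph V E} {C : Set ℂ} (σ : G.CrossSection C) :
    Set V :=
  {v | ∃ i ≤ σ.size, σ.pt i = G.pos v}

/-- The links that lie in a region of the plane. -/
def linksIn (G : PlaneEulerianGraph V E) (R : Set ℂ) : Set E := {e | G.linkInterior e ⊆ R}

/-- The region `R` lies on the anticlockwise side of the section `σ` (the left side, when `σ` is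
followed from the inside to the outside). The boundary of `R` cuts no link, and at each vertex
crossed by `σ` the region contains the germ of the plane to the left of `σ` and misses the germ to
its right. Away from the section `R` is arbitrary. -/
structure IsAnticlockwiseSide (G : PlaneEulerianGraph V E) {C : Set ℂ} (σ : G.CrossSection C)
    (R : Set ℂ) : Prop where
  link_side : ∀ e, G.linkInterior e ⊆ R ∨ Disjoint (G.linkInterior e) R
  left_mem : ∀ i, i + 1 < σ.size → ∀ v, σ.pt (i + 1) = G.pos v → ∀ d,
    IsLeftOf (σ.pt i - σ.pt (i + 1)) (σ.pt (i + 2) - σ.pt (i + 1)) d →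
    ∀ᶠ t : ℝ in 𝓝[>] 0, G.pos v + (t : ℂ) * d ∈ R
  right_notMem : ∀ i, i + 1 < σ.size → ∀ v, σ.pt (i + 1) = G.pos v → ∀ d,
    IsRightOf (σ.pt i - σ.pt (i + 1)) (σ.pt (i + 2) - σ.pt (i + 1)) d →
    ∀ᶠ t : ℝ in 𝓝[>] 0, G.pos v + (t : ℂ) * d ∉ R

/-- The set `Q` of links singles out the section `σ` among all the places where links of `R` meet
links outside `R`: it contains every link pointing towards a vertex of `σ`, and no link pointing
towards another vertex at which links inside `R` and links outside `R` meet. -/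
structure SinglesOut (G : PlaneEulerianGraph V E) {C : Set ℂ} (σ : G.CrossSection C)
    (R : Set ℂ) (Q : Set E) : Prop where
  mem : ∀ e, G.tgt e ∈ σ.vertices → e ∈ Q
  notMem : ∀ e, G.tgt e ∉ σ.vertices →
    (∃ e₁, (G.src e₁ = G.tgt e ∨ G.tgt e₁ = G.tgt e) ∧ e₁ ∈ G.linksIn R) →
    (∃ e₂, (G.src e₂ = G.tgt e ∨ G.tgt e₂ = G.tgt e) ∧ e₂ ∉ G.linksIn R) → e ∉ Q

end PlaneEulerianGraph

end

/-! Both sides of the equality are computed from one function: the winding number `winding z` of the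
graph around `z`, the total angle under which the links are seen from `z`, divided by `2π`. As many
links enter as leave each vertex, so modulo `2π` the arguments at the corners cancel
(`sum_pieces_sub`). Hence `winding` is an integer off the graph; it is continuous there and tends to
`0` at infinity, so it is constant on each face and zero on the exterior. Its value on `C` is the
integer sought. Crossing lines: for two segments `pq` and `ab` in general position, a sum of four
view angles is `2π` times the sign of their crossing (`quadrilateral_angle_sum`). Summed over all
pieces of links, the angles seen from `a` and `b` cancel, again by balance, and `winding p - winding
q` is left. A half-line is a limit of long segments. Sections: when the section passes through a
vertex `v`, only the pieces ending at `v` change their view angle by a jump. The jump of `winding`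
is `netOut P v`, the number of links on the left that leave `v` minus the number of those that enter
it (`tendsto_winding_sub_winding`). These jumps add up along the section to the value on `C`. Flow:
by unitarity the links entering `v` contribute exactly `netOut P v` to the trace, whatever the
amplitudes (`sum_tgt_sub`). Vertices off the section contribute nothing, so the flow is the same
sum. -/

/-! ### View angles and the crossing of two segments. -/

/-- The oriented angle in `(-π, π]` under which the segment from `a` to `b` is seen from `z`. -/
noncomputable def viewAngle (z a b : ℂ) : ℝ := Complex.arg ((b - z) / (a - z))

/-- If the quotient were `-r` with `r ≥ 0`, then `z` would be the convex combination of `a` and `b`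
with weights `r / (1 + r)` and `1 / (1 + r)`. So off the segment the view angle stays away from the
cut of `Complex.arg`. -/
theorem sub_div_sub_mem_slitPlane {z a b : ℂ} (h : z ∉ segment ℝ a b) :
    (b - z) / (a - z) ∈ Complex.slitPlane := by
  by_contra hs
  apply h
  have ha : a - z ≠ 0 := by
    intro h0
    exact h (by rw [← sub_eq_zero.1 h0]; exact left_mem_segment ℝ a b)
  rw [Complex.mem_slitPlane_iff, not_or, not_lt, not_not] at hs
  obtain ⟨r, hr⟩ : ∃ r : ℝ, r = -((b - z) / (a - z)).re := ⟨_, rfl⟩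
  have hr0 : 0 ≤ r := by linarith [hs.1]
  have hq : (b - z) / (a - z) = -(r : ℂ) := by
    apply Complex.ext <;> simp [hr, hs.2]
  rw [div_eq_iff ha] at hq
  have h1 : (1 + r : ℂ) ≠ 0 := by
    have : (1 + r : ℝ) ≠ 0 := by positivity
    exact_mod_cast this
  refine ⟨r / (1 + r), 1 / (1 + r), by positivity, by positivity, by field_simp; ring, ?_⟩
  simp only [Complex.real_smul]
  push_cast
  field_simp
  linear_combination hq

theorem ContinuousAt.viewAngle {X : Type*} [TopologicalSpace X] {f g h : X → ℂ} {x : X}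
    (hf : ContinuousAt f x) (hg : ContinuousAt g x) (hh : ContinuousAt h x)
    (hx : f x ∉ segment ℝ (g x) (h x)) :
    ContinuousAt (fun y => viewAngle (f y) (g y) (h y)) x := by
  have ha : g x - f x ≠ 0 := by
    intro h0
    exact hx (by rw [← sub_eq_zero.1 h0]; exact left_mem_segment ℝ _ _)
  exact ContinuousAt.comp (f := fun y => (h y - f y) / (g y - f y)) (g := Complex.arg)
    (Complex.continuousAt_arg (sub_div_sub_mem_slitPlane hx))
    ((hh.sub hf).div (hg.sub hf) ha)

theorem viewAngle_swap {z a b : ℂ} (h : z ∉ segment ℝ a b) :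
    viewAngle z b a = -viewAngle z a b := by
  have := Complex.mem_slitPlane_iff_arg.1 (sub_div_sub_mem_slitPlane h)
  rw [viewAngle, viewAngle, ← inv_div, Complex.arg_inv, if_neg this.1]

theorem viewAngle_mem_Ioo {z a b : ℂ} (h : z ∉ segment ℝ a b) :
    -Real.pi < viewAngle z a b ∧ viewAngle z a b < Real.pi :=
  ⟨Complex.neg_pi_lt_arg _, lt_of_le_of_ne (Complex.arg_le_pi _)
    (Complex.mem_slitPlane_iff_arg.1 (sub_div_sub_mem_slitPlane h)).1⟩

theorem coe_viewAngle {z a b : ℂ} (h : z ∉ segment ℝ a b) :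
    (viewAngle z a b : Real.Angle) = (b - z).arg - (a - z).arg := by
  refine Complex.arg_div_coe_angle ?_ ?_ <;> intro h0 <;> apply h <;> rw [← sub_eq_zero.1 h0]
  exacts [right_mem_segment ℝ _ _, left_mem_segment ℝ _ _]

theorem viewAngle_self (z a : ℂ) : viewAngle z a a = 0 := by
  by_cases h : a - z = 0 <;> simp [viewAngle, h]

theorem viewAngle_pos_of_wedge_pos {z a b : ℂ} (h : 0 < wedge (a - z) (b - z)) : 0 < viewAngle z a b := by
  have ha : a - z ≠ 0 := by
    intro h0; simp [wedge, h0] at h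
  have him : 0 < ((b - z) / (a - z)).im := by
    rw [Complex.div_im]
    have := Complex.normSq_pos.2 ha
    rw [div_sub_div_same]
    apply div_pos _ this
    unfold wedge at h; linarith
  have h1 : 0 ≤ viewAngle z a b := Complex.arg_nonneg_iff.2 him.le
  refine lt_of_le_of_ne h1 fun h2 => ?_
  have := Complex.arg_eq_zero_iff.1 h2.symm
  linarith [this.2]

theorem exists_int_of_angle_eq_zero {x : ℝ} (h : (x : Real.Angle) = 0) :
    ∃ n : ℤ, x = 2 * Real.pi * n := by
  obtain ⟨n, hn⟩ := Real.Angle.coe_eq_zero_iff.1 h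
  exact ⟨n, by rw [← hn]; simp [mul_comm]⟩

theorem IsPreconnected.eq_of_mapsTo_int {X : Type*} [TopologicalSpace X] {s : Set X}
    (hs : IsPreconnected s) {f : X → ℝ} (hf : ContinuousOn f s)
    (hn : ∀ x ∈ s, ∃ n : ℤ, f x = n) {x y : X} (hx : x ∈ s) (hy : y ∈ s) : f x = f y := by
  have hd := Int.isClosedEmbedding_coe_real.isEmbedding.isDiscrete_range
  obtain ⟨c, hc⟩ := hs.eqOn_const_of_mapsTo hd hf
    (fun x hx => (hn x hx).imp fun n h => h.symm) ⟨0, 0, by simp⟩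
  rw [hc.2 hx, hc.2 hy]; rfl

/-- Modulo `2π` every view angle is a difference of two arguments. The eight arguments pair into
opposite vectors, each pair differing by `π`, and the four `π` cancel. -/
theorem quadrilateral_angle_sum_mem {p q a b : ℂ} (ha : a ∉ segment ℝ p q)
    (hb : b ∉ segment ℝ p q) (hp : p ∉ segment ℝ a b) (hq : q ∉ segment ℝ a b) :
    ∃ n : ℤ, viewAngle p a b - viewAngle q a b + viewAngle b p q - viewAngle a p q
      = 2 * Real.pi * n := by
  apply exists_int_of_angle_eq_zero
  have hn : ∀ {x y z w : ℂ}, x ∉ segment ℝ z w → z = y ∨ w = y →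
      ((x - y).arg : Real.Angle) = (y - x).arg + (Real.pi : ℝ) := by
    intro x y z w hx hy
    rw [← neg_sub y x]
    refine Complex.arg_neg_coe_angle fun h0 => hx ?_
    rw [← sub_eq_zero.1 h0]
    rcases hy with rfl | rfl
    exacts [left_mem_segment ℝ _ _, right_mem_segment ℝ _ _]
  rw [Real.Angle.coe_sub, Real.Angle.coe_add, Real.Angle.coe_sub, coe_viewAngle ha, coe_viewAngle hb, coe_viewAngle hp, coe_viewAngle hq,
    hn hp (Or.inl rfl), hn hq (Or.inl rfl), hn hp (Or.inr rfl), hn hq (Or.inr rfl)]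
  abel

/-- Retract `q` to `p` along the segment: the sum stays defined and continuous, takes values in
`2πℤ`, and vanishes when the two points coincide. -/
theorem quadrilateral_angle_sum_of_disjoint {p q a b : ℂ}
    (h : ¬(segment ℝ p q ∩ segment ℝ a b).Nonempty) :
    viewAngle p a b - viewAngle q a b + viewAngle b p q - viewAngle a p q = 0 := by
  have hsub : ∀ t ∈ Icc (0 : ℝ) 1, segment ℝ p (AffineMap.lineMap p q t) ⊆ segment ℝ p q :=
    fun t ht => (convex_segment p q).segment_subset (left_mem_segment ℝ p q)
      (by rw [segment_eq_image_lineMap]; exact ⟨t, ht, rfl⟩)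
  have hd : ∀ x ∈ segment ℝ p q, x ∉ segment ℝ a b := fun x hx hx' => h ⟨x, hx, hx'⟩
  have hc : ∀ x ∈ segment ℝ a b, x ∉ segment ℝ p q := fun x hx hx' => h ⟨x, hx', hx⟩
  have ha := hc a (left_mem_segment ℝ a b)
  have hb := hc b (right_mem_segment ℝ a b)
  have hp := hd p (left_mem_segment ℝ p q)
  have hline : Continuous fun t : ℝ => (AffineMap.lineMap p q t : ℂ) :=
    AffineMap.lineMap_continuous
  have hm : ∀ t ∈ Icc (0 : ℝ) 1, (AffineMap.lineMap p q t : ℂ) ∉ segment ℝ a b :=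
    fun t ht => hd _ (hsub t ht (right_mem_segment ℝ _ _))
  have hpi := Real.pi_pos
  have := isPreconnected_Icc.eq_of_mapsTo_int (s := Icc (0 : ℝ) 1)
    (f := fun t => (viewAngle p a b - viewAngle (AffineMap.lineMap p q t) a b
      + viewAngle b p (AffineMap.lineMap p q t) - viewAngle a p (AffineMap.lineMap p q t))
        / (2 * Real.pi)) ?_ ?_ (left_mem_Icc.2 zero_le_one) (right_mem_Icc.2 zero_le_one)
  · simp only [AffineMap.lineMap_apply_zero, AffineMap.lineMap_apply_one, viewAngle_self] at this
    rw [eq_div_iff (by positivity)] at this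
    rw [← this]; simp
  · intro t ht
    refine ContinuousAt.continuousWithinAt (ContinuousAt.div_const ?_ _)
    exact ((continuousAt_const.sub (hline.continuousAt.viewAngle continuousAt_const
      continuousAt_const (hm t ht))).add (continuousAt_const.viewAngle continuousAt_const
      hline.continuousAt fun h' => hb (hsub t ht h'))).sub
      (continuousAt_const.viewAngle continuousAt_const
      hline.continuousAt fun h' => ha (hsub t ht h'))
  · intro t ht
    obtain ⟨n, hn⟩ := quadrilateral_angle_sum_mem (fun h' => ha (hsub t ht h'))
      (fun h' => hb (hsub t ht h')) hp (hm t ht)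
    exact ⟨n, by rw [hn]; field_simp⟩

theorem viewAngle_neg_of_wedge_neg {z a b : ℂ} (h : z ∉ segment ℝ a b)
    (h' : wedge (a - z) (b - z) < 0) : viewAngle z a b < 0 := by
  have := viewAngle_pos_of_wedge_pos (z := z) (a := b) (b := a) (by unfold wedge at *; linarith)
  rw [viewAngle_swap h] at this
  linarith

/-- Collinear segments that meet have an endpoint in common with the other segment. -/
theorem exists_endpoint_mem_of_collinear {p a b u : ℂ} {k s t : ℝ} (hs : s ∈ Icc (0 : ℝ) 1)
    (ht : t ∈ Icc (0 : ℝ) 1) (hab : b - a = k * u) (hx : p + s * u = a + t * (b - a)) :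
    a ∈ segment ℝ p (p + u) ∨ b ∈ segment ℝ p (p + u) ∨ p ∈ segment ℝ a b ∨
      p + u ∈ segment ℝ a b := by
  have ha : a = p + ((s - t * k : ℝ) : ℂ) * u := by
    push_cast; rw [hab] at hx; linear_combination -hx
  have hb : b = p + ((s + (1 - t) * k : ℝ) : ℂ) * u := by
    push_cast; rw [hab] at hx; linear_combination hab - hx
  have key : ∀ r ∈ Icc (0 : ℝ) 1, p + (r : ℂ) * u ∈ segment ℝ p (p + u) := by
    intro r hr
    rw [segment_eq_image_lineMap]
    exact ⟨r, hr, by simp [AffineMap.lineMap_apply]; ring⟩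
  by_cases h1 : s - t * k ∈ Icc (0 : ℝ) 1
  · left; rw [ha]; exact key _ h1
  by_cases h2 : s + (1 - t) * k ∈ Icc (0 : ℝ) 1
  · right; left; rw [hb]; exact key _ h2
  right; right; left
  obtain ⟨hs0, hs1⟩ := hs
  obtain ⟨ht0, ht1⟩ := ht
  have hk : k ≠ 0 := by
    rintro rfl; apply h1; simp [hs0, hs1]
  -- The parameter of `p` on the segment from `a` to `b`. With both `a` and `b` outside the segment
  -- from `p` to `p + u`, they lie on opposite sides of it, so `p` is between them.
  have ht0' : t - s / k ∈ Icc (0 : ℝ) 1 := by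
    have e1 : t - s / k = -(s - t * k) / k := by field_simp; ring
    have e2 : 1 - (t - s / k) = (s + (1 - t) * k) / k := by field_simp; ring
    have h12 : 0 ≤ (t - s / k) ∧ 0 ≤ 1 - (t - s / k) := by
      rw [e2, e1]
      rcases lt_or_gt_of_ne hk with hk | hk
      · have h3 : 1 < s - t * k := by
          by_contra h3
          exact h1 ⟨by nlinarith, not_lt.1 h3⟩
        have h4 : s + (1 - t) * k < 0 := by
          by_contra h4
          exact h2 ⟨not_lt.1 h4, by nlinarith⟩
        exact ⟨div_nonneg_of_nonpos (by linarith) hk.le, div_nonneg_of_nonpos h4.le hk.le⟩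
      · have h3 : s - t * k < 0 := by
          by_contra h3
          exact h1 ⟨not_lt.1 h3, by nlinarith⟩
        have h4 : 1 < s + (1 - t) * k := by
          by_contra h4
          exact h2 ⟨by nlinarith, not_lt.1 h4⟩
        exact ⟨div_nonneg (by linarith) hk.le, div_nonneg (by linarith) hk.le⟩
    exact ⟨h12.1, by linarith [h12.2]⟩
  rw [segment_eq_image_lineMap]
  refine ⟨t - s / k, ht0', ?_⟩
  have hkc : (k : ℂ) ≠ 0 := by exact_mod_cast hk
  simp only [AffineMap.lineMap_apply, vsub_eq_sub, hab, Complex.real_smul, vadd_eq_add]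
  rw [ha]; push_cast; field_simp; ring

theorem wedge_ne_zero_of_crossing {p q a b : ℂ} (ha : a ∉ segment ℝ p q)
    (hb : b ∉ segment ℝ p q) (hp : p ∉ segment ℝ a b) (hq : q ∉ segment ℝ a b) {s t : ℝ}
    (hs : s ∈ Icc (0 : ℝ) 1) (ht : t ∈ Icc (0 : ℝ) 1)
    (hx : p + s * (q - p) = a + t * (b - a)) : wedge (q - p) (b - a) ≠ 0 := by
  intro h0
  have hu : q - p ≠ 0 := by
    intro hu
    apply hp
    rw [segment_eq_image_lineMap]
    exact ⟨t, ht, by simp [AffineMap.lineMap_apply]; rw [hu] at hx; linear_combination -hx⟩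
  obtain ⟨k, hk⟩ : ∃ k : ℝ, b - a = k * (q - p) := by
    refine ⟨((b - a) / (q - p)).re, ?_⟩
    rw [← div_eq_iff hu]
    apply Complex.ext
    · simp
    · rw [Complex.div_im, div_sub_div_same, Complex.ofReal_im]
      unfold wedge at h0
      rw [div_eq_zero_iff]; left; linarith
  have := exists_endpoint_mem_of_collinear hs ht hk hx
  rw [add_sub_cancel] at this
  tauto

/-- At a crossing the four wedges are multiples of `wedge (q - p) (b - a)`, with signs such that all
four terms of the sum have the sign of the crossing. Each is smaller than `π` in absolute value, so
the multiple of `2π` must be `±1`. -/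
theorem quadrilateral_angle_sum {p q a b : ℂ} (ha : a ∉ segment ℝ p q)
    (hb : b ∉ segment ℝ p q) (hp : p ∉ segment ℝ a b) (hq : q ∉ segment ℝ a b) :
    viewAngle p a b - viewAngle q a b + viewAngle b p q - viewAngle a p q
      = 2 * Real.pi * crossingSign (segment ℝ p q) (q - p) a b := by
  unfold crossingSign
  split_ifs with h
  swap
  · rw [quadrilateral_angle_sum_of_disjoint h]; simp
  obtain ⟨x, hx1, hx2⟩ := h
  rw [segment_eq_image_lineMap] at hx1 hx2
  obtain ⟨s, hs, rfl⟩ := hx1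
  obtain ⟨t, ht, hst⟩ := hx2
  simp only [AffineMap.lineMap_apply, vsub_eq_sub, Complex.real_smul, vadd_eq_add] at hst
  have hw := wedge_ne_zero_of_crossing ha hb hp hq hs ht (by linear_combination -hst)
  obtain ⟨n, hn⟩ := quadrilateral_angle_sum_mem ha hb hp hq
  have hs0 : 0 < s := by
    refine lt_of_le_of_ne hs.1 fun h0 => hp ?_
    rw [segment_eq_image_lineMap]
    exact ⟨t, ht, by simp [AffineMap.lineMap_apply]; rw [← h0] at hst; simp at hst; exact hst⟩
  have hs1 : s < 1 := by
    refine lt_of_le_of_ne hs.2 fun h0 => hq ?_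
    rw [segment_eq_image_lineMap]
    exact ⟨t, ht, by simp [AffineMap.lineMap_apply]; rw [h0] at hst; simp at hst; exact hst⟩
  have ht0 : 0 < t := by
    refine lt_of_le_of_ne ht.1 fun h0 => ha ?_
    rw [segment_eq_image_lineMap]
    exact ⟨s, hs, by simp [AffineMap.lineMap_apply]; rw [← h0] at hst; simp at hst; exact hst.symm⟩
  have ht1 : t < 1 := by
    refine lt_of_le_of_ne ht.2 fun h0 => hb ?_
    rw [segment_eq_image_lineMap]
    exact ⟨s, hs, by simp [AffineMap.lineMap_apply]; rw [h0] at hst; simp at hst; exact hst.symm⟩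
  have hre : t * (b.re - a.re) + a.re = s * (q.re - p.re) + p.re := by
    simpa using congrArg Complex.re hst
  have him : t * (b.im - a.im) + a.im = s * (q.im - p.im) + p.im := by
    simpa using congrArg Complex.im hst
  have w1 : wedge (a - p) (b - p) = s * wedge (q - p) (b - a) := by
    simp only [wedge, Complex.sub_re, Complex.sub_im]
    linear_combination (b.im - a.im) * hre - (b.re - a.re) * him
  have w2 : wedge (a - q) (b - q) = -((1 - s) * wedge (q - p) (b - a)) := by
    simp only [wedge, Complex.sub_re, Complex.sub_im]
    linear_combination (b.im - a.im) * hre - (b.re - a.re) * him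
  have w3 : wedge (p - b) (q - b) = (1 - t) * wedge (q - p) (b - a) := by
    simp only [wedge, Complex.sub_re, Complex.sub_im]
    linear_combination (q.re - p.re) * him - (q.im - p.im) * hre
  have w4 : wedge (p - a) (q - a) = -(t * wedge (q - p) (b - a)) := by
    simp only [wedge, Complex.sub_re, Complex.sub_im]
    linear_combination (q.re - p.re) * him - (q.im - p.im) * hre
  have b1 := viewAngle_mem_Ioo hp
  have b2 := viewAngle_mem_Ioo hq
  have b3 := viewAngle_mem_Ioo hb
  have b4 := viewAngle_mem_Ioo ha
  have hpi := Real.pi_pos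
  rw [hn]
  rcases lt_or_gt_of_ne hw with h | h
  · rw [sign_neg h]
    have v1 := viewAngle_neg_of_wedge_neg hp (by rw [w1]; nlinarith)
    have v2 := viewAngle_pos_of_wedge_pos (z := q) (a := a) (b := b) (by rw [w2]; nlinarith)
    have v3 := viewAngle_neg_of_wedge_neg hb (by rw [w3]; nlinarith)
    have v4 := viewAngle_pos_of_wedge_pos (z := a) (a := p) (b := q) (by rw [w4]; nlinarith)
    have n1 : (n : ℝ) < 0 := by
      by_contra hh; push Not at hh
      have := mul_nonneg (mul_nonneg zero_le_two hpi.le) hh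
      linarith
    have n2 : (-2 : ℝ) < n := by
      by_contra hh; push Not at hh
      nlinarith
    have : n = -1 := by
      have n1' : n < 0 := by exact_mod_cast n1
      have n2' : -2 < n := by exact_mod_cast n2
      omega
    simp [this]
  · rw [sign_pos h]
    have v1 := viewAngle_pos_of_wedge_pos (z := p) (a := a) (b := b) (by rw [w1]; exact mul_pos hs0 h)
    have v2 := viewAngle_neg_of_wedge_neg hq (by rw [w2]; nlinarith)
    have v3 := viewAngle_pos_of_wedge_pos (z := b) (a := p) (b := q) (by rw [w3]; nlinarith)
    have v4 := viewAngle_neg_of_wedge_neg ha (by rw [w4]; nlinarith)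
    have n1 : (0 : ℝ) < n := by
      by_contra hh; push Not at hh
      nlinarith
    have n2 : (n : ℝ) < 2 := by
      by_contra hh; push Not at hh
      nlinarith
    have : n = 1 := by
      have n1' : 0 < n := by exact_mod_cast n1
      have n2' : n < 2 := by exact_mod_cast n2
      omega
    simp [this]

/-! ### The winding number around a point, and the crossings of a line. -/

namespace PlaneEulerianGraph

variable {V E : Type*} [Fintype E] [DecidableEq V]

theorem sum_tgt_eq_sum_src (G : PlaneEulerianGraph V E) {M : Type*} [AddCommMonoid M]
    (g : V → M) : ∑ e, g (G.tgt e) = ∑ e, g (G.src e) := by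
  -- Balance lets the incoming links of each vertex be matched with its outgoing links; `φ` sends a
  -- link to the one that precedes it in this matching.
  let φ : E ≃ E := (Equiv.sigmaFiberEquiv G.src).symm.trans
    ((Equiv.sigmaCongrRight fun v => Fintype.equivOfCardEq (G.balanced v).symm).trans
      (Equiv.sigmaFiberEquiv G.tgt))
  have h : ∀ e, G.tgt (φ e) = G.src e := fun e =>
    (Fintype.equivOfCardEq (G.balanced (G.src e)).symm ⟨e, rfl⟩).2
  rw [← Equiv.sum_comp φ]
  simp only [h]

/-- Each link telescopes to its two ends, and the ends cancel by balance. This serves for `h x = arg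
(x - z)` (integrality) and for `h x = viewAngle x p q` (crossings). -/
theorem sum_pieces_sub (G : PlaneEulerianGraph V E) {M : Type*} [AddCommGroup M] (h : ℂ → M) :
    ∑ e, ∑ i ∈ Finset.range (G.size e), (h (G.corner e (i + 1)) - h (G.corner e i)) = 0 := by
  simp only [fun e => Finset.sum_range_sub (fun i => h (G.corner e i)) (G.size e),
    G.corner_zero, G.corner_size, Finset.sum_sub_distrib]
  rw [G.sum_tgt_eq_sum_src fun v => h (G.pos v), sub_self]

theorem segment_subset_support (G : PlaneEulerianGraph V E) {e : E} {i : ℕ} (hi : i < G.size e) :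
    segment ℝ (G.corner e i) (G.corner e (i + 1)) ⊆ G.support :=
  fun _ hz => Or.inr (mem_iUnion.2 ⟨e, mem_iUnion.2 ⟨i, mem_iUnion.2 ⟨hi, hz⟩⟩⟩)

/-- The winding number of the graph around a point, as a sum of angles. -/
noncomputable def winding (G : PlaneEulerianGraph V E) (z : ℂ) : ℝ :=
  (∑ e, ∑ i ∈ Finset.range (G.size e), viewAngle z (G.corner e i) (G.corner e (i + 1)))
    / (2 * Real.pi)

theorem exists_int_winding (G : PlaneEulerianGraph V E) {z : ℂ} (hz : z ∉ G.support) :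
    ∃ n : ℤ, G.winding z = n := by
  have h : ((∑ e, ∑ i ∈ Finset.range (G.size e),
      viewAngle z (G.corner e i) (G.corner e (i + 1)) : ℝ) : Real.Angle) = 0 := by
    rw [← G.sum_pieces_sub fun x => ((x - z).arg : Real.Angle), ← Real.Angle.coe_coeHom]
    simp only [map_sum]
    refine Finset.sum_congr rfl fun e _ => Finset.sum_congr rfl fun i hi => ?_
    exact coe_viewAngle fun h => hz (G.segment_subset_support (Finset.mem_range.1 hi) h)
  obtain ⟨n, hn⟩ := exists_int_of_angle_eq_zero h
  exact ⟨n, by rw [winding, hn]; have := Real.pi_pos; field_simp⟩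

theorem continuousOn_winding (G : PlaneEulerianGraph V E) : ContinuousOn G.winding G.supportᶜ := by
  intro z hz
  refine (ContinuousAt.div_const (tendsto_finsetSum _ fun e _ => tendsto_finsetSum _
    fun i hi => ?_) _).continuousWithinAt
  exact continuousAt_id.viewAngle continuousAt_const continuousAt_const
    fun h => hz (G.segment_subset_support (Finset.mem_range.1 hi) h)

theorem winding_eq_of_isPreconnected (G : PlaneEulerianGraph V E) {s : Set ℂ}
    (hs : IsPreconnected s) (hd : s ⊆ G.supportᶜ) {x y : ℂ} (hx : x ∈ s) (hy : y ∈ s) :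
    G.winding x = G.winding y :=
  hs.eq_of_mapsTo_int (G.continuousOn_winding.mono hd) (fun _ h => G.exists_int_winding (hd h)) hx hy

theorem tendsto_viewAngle_cobounded (a b : ℂ) :
    Tendsto (fun z => viewAngle z a b) (Bornology.cobounded ℂ) (𝓝 0) := by
  have h1 : Tendsto (fun z => (b - z) / (a - z)) (Bornology.cobounded ℂ) (𝓝 1) := by
    have h2 : Tendsto (fun z => 1 + (b - a) * (a - z)⁻¹) (Bornology.cobounded ℂ) (𝓝 1) := by
      simpa using ((tendsto_inv₀_cobounded.comp
        (tendsto_const_sub_cobounded a)).const_mul (b - a)).const_add 1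
    refine h2.congr' ?_
    filter_upwards [Bornology.eventually_ne_cobounded a] with z hz
    have : a - z ≠ 0 := sub_ne_zero.2 hz.symm
    field_simp; ring
  rw [← Complex.arg_one]
  exact (Complex.continuousAt_arg Complex.one_mem_slitPlane).tendsto.comp h1

theorem tendsto_winding_cobounded (G : PlaneEulerianGraph V E) :
    Tendsto G.winding (Bornology.cobounded ℂ) (𝓝 0) := by
  have := (tendsto_finsetSum Finset.univ fun e _ => tendsto_finsetSum (Finset.range (G.size e))
    fun i _ => tendsto_viewAngle_cobounded (G.corner e i) (G.corner e (i + 1))).div_const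
      (2 * Real.pi)
  simp only [Finset.sum_const_zero, zero_div] at this
  exact this

theorem isCompact_support [Finite V] (G : PlaneEulerianGraph V E) : IsCompact G.support := by
  refine (finite_range _).isCompact.union (isCompact_iUnion fun e => ?_)
  refine (finite_lt_nat (G.size e)).isCompact_biUnion fun i _ => ?_
  rw [segment_eq_image_lineMap]
  exact isCompact_Icc.image AffineMap.lineMap_continuous

theorem exterior_subset (G : PlaneEulerianGraph V E) : G.exterior ⊆ G.supportᶜ := by
  intro z hz
  by_contra h
  apply hz
  rw [connectedComponentIn_eq_empty h]
  exact Bornology.isBounded_empty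

/-- An unbounded component reaches infinity, where `winding` tends to `0`, and `winding` is constant
on it. -/
theorem winding_eq_zero_of_mem_exterior (G : PlaneEulerianGraph V E) {z : ℂ}
    (hz : z ∈ G.exterior) : G.winding z = 0 := by
  have hne : (Bornology.cobounded ℂ ⊓ 𝓟 (connectedComponentIn G.supportᶜ z)).NeBot := by
    rw [neBot_iff, Ne, inf_principal_eq_bot]
    exact fun h => hz (Bornology.isBounded_def.2 h)
  refine tendsto_nhds_unique (l := Bornology.cobounded ℂ ⊓ 𝓟 (connectedComponentIn G.supportᶜ z))
    ?_ (G.tendsto_winding_cobounded.mono_left inf_le_left)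
  refine tendsto_const_nhds.congr' ?_
  filter_upwards [mem_inf_of_right (mem_principal_self _)] with y hy
  exact G.winding_eq_of_isPreconnected isPreconnected_connectedComponentIn
    (connectedComponentIn_subset _ _) (mem_connectedComponentIn (G.exterior_subset hz)) hy

theorem winding_sub_winding (G : PlaneEulerianGraph V E) {p q : ℂ} (hp : p ∉ G.support)
    (hq : q ∉ G.support) (hc : ∀ e, ∀ i ≤ G.size e, G.corner e i ∉ segment ℝ p q) :
    G.winding p - G.winding q = ((∑ e, ∑ i ∈ Finset.range (G.size e),
      crossingSign (segment ℝ p q) (q - p) (G.corner e i) (G.corner e (i + 1)) : ℤ) : ℝ) := by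
  rw [winding, winding, ← sub_div, div_eq_iff (by have := Real.pi_pos; positivity), mul_comm]
  have h := G.sum_pieces_sub fun x => viewAngle x p q
  rw [← add_zero (_ - _), ← h]
  push_cast
  simp only [Finset.mul_sum, ← Finset.sum_sub_distrib, ← Finset.sum_add_distrib]
  refine Finset.sum_congr rfl fun e _ => Finset.sum_congr rfl fun i hi => ?_
  rw [Finset.mem_range] at hi
  rw [← quadrilateral_angle_sum (hc e i hi.le) (hc e (i + 1) hi)
    (fun h => hp (G.segment_subset_support hi h)) (fun h => hq (G.segment_subset_support hi h))]
  ring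

theorem segment_subset_halfLine {p u : ℂ} {t : ℝ} (ht : 0 ≤ t) :
    segment ℝ p (p + t * u) ⊆ halfLine p u := by
  rintro z hz
  rw [segment_eq_image_lineMap] at hz
  obtain ⟨s, hs, rfl⟩ := hz
  exact ⟨s * t, mul_nonneg hs.1 ht, by simp [AffineMap.lineMap_apply]; ring⟩

theorem eventually_mem_segment_of_mem_halfLine {p u : ℂ} {z : ℂ} (hz : z ∈ halfLine p u) :
    ∀ᶠ t : ℝ in atTop, z ∈ segment ℝ p (p + t * u) := by
  obtain ⟨s, hs, rfl⟩ := hz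
  filter_upwards [eventually_ge_atTop s, eventually_gt_atTop 0] with t ht ht0
  rw [segment_eq_image_lineMap]
  refine ⟨s / t, ⟨by positivity, (div_le_one ht0).2 ht⟩, ?_⟩
  have : (t : ℂ) ≠ 0 := by exact_mod_cast ht0.ne'
  simp [AffineMap.lineMap_apply]; field_simp; ring

theorem eventually_crossingSign_halfLine (p u a b : ℂ) :
    ∀ᶠ t : ℝ in atTop, crossingSign (segment ℝ p (p + t * u)) (p + t * u - p) a b
      = crossingSign (halfLine p u) u a b := by
  have hw : ∀ t : ℝ, 0 < t → SignType.sign (wedge (p + t * u - p) (b - a))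
      = SignType.sign (wedge u (b - a)) := by
    intro t ht
    have : wedge (p + t * u - p) (b - a) = t * wedge u (b - a) := by simp [wedge]; ring
    rw [this, sign_mul, sign_pos ht, one_mul]
  unfold crossingSign
  by_cases h : (halfLine p u ∩ segment ℝ a b).Nonempty
  · obtain ⟨z, hz, hz'⟩ := h
    filter_upwards [eventually_mem_segment_of_mem_halfLine hz, eventually_gt_atTop 0] with t h1 ht
    rw [if_pos ⟨z, h1, hz'⟩, if_pos ⟨z, hz, hz'⟩, hw t ht]
  · filter_upwards [eventually_gt_atTop 0] with t ht
    rw [if_neg h, if_neg fun h' => h (h'.mono (inter_subset_inter_left _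
      (segment_subset_halfLine ht.le)))]

theorem tendsto_ray_cobounded (p : ℂ) {u : ℂ} (hu : u ≠ 0) :
    Tendsto (fun t : ℝ => p + t * u) atTop (Bornology.cobounded ℂ) := by
  refine (tendsto_const_add_cobounded p).comp ?_
  rw [← tendsto_norm_atTop_iff_cobounded]
  simp only [norm_mul, Complex.norm_real, Real.norm_eq_abs]
  exact tendsto_abs_atTop_atTop.atTop_mul_const (norm_pos_iff.2 hu)

/-- Cut the half-line at a far point: the winding number there tends to `0`, while the crossings of
the cut segment are eventually those of the half-line. -/
theorem winding_eq_halfLine [Finite V] (G : PlaneEulerianGraph V E) {p u : ℂ} (hu : u ≠ 0)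
    (hp : p ∉ G.support) (hc : ∀ e, ∀ i ≤ G.size e, G.corner e i ∉ halfLine p u) :
    G.winding p = ((∑ e, ∑ i ∈ Finset.range (G.size e),
      crossingSign (halfLine p u) u (G.corner e i) (G.corner e (i + 1)) : ℤ) : ℝ) := by
  have h1 := (G.tendsto_winding_cobounded.comp (tendsto_ray_cobounded p hu)).const_sub (G.winding p)
  rw [sub_zero] at h1
  refine tendsto_nhds_unique h1 (tendsto_const_nhds.congr' ?_)
  have h2 : ∀ᶠ t : ℝ in atTop, ∀ e, ∀ i ∈ Finset.range (G.size e),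
      crossingSign (segment ℝ p (p + t * u)) (p + t * u - p) (G.corner e i) (G.corner e (i + 1))
      = crossingSign (halfLine p u) u (G.corner e i) (G.corner e (i + 1)) :=
    eventually_all.2 fun e => (Finset.eventually_all _).2 fun i _ =>
      eventually_crossingSign_halfLine _ _ _ _
  have h3 : ∀ᶠ t : ℝ in atTop, p + t * u ∈ G.supportᶜ :=
    (tendsto_ray_cobounded p hu).eventually (Bornology.isBounded_def.1 G.isCompact_support.isBounded)
  filter_upwards [h2, h3, eventually_ge_atTop 0] with t ht2 ht3 ht
  rw [Function.comp, G.winding_sub_winding hp ht3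
    fun e i hi h => hc e i hi (segment_subset_halfLine ht h)]
  congr 1
  exact Finset.sum_congr rfl fun e _ => Finset.sum_congr rfl fun i hi => (ht2 e i hi).symm

theorem crossingNumber_eq_winding [Finite V] (G : PlaneEulerianGraph V E) {C : Set ℂ}
    (L : G.TransverseLine C) : (G.crossingNumber L : ℝ) = G.winding (L.pt 0) := by
  have h1 := G.winding_eq_halfLine L.dir_ne_zero (L.pt_notMem L.size le_rfl)
    fun e i hi => (L.corner_notMem e i hi).2
  have h2 : ∀ j ∈ Finset.range L.size, ((∑ e, ∑ i ∈ Finset.range (G.size e),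
      crossingSign (segment ℝ (L.pt j) (L.pt (j + 1))) (L.pt (j + 1) - L.pt j)
        (G.corner e i) (G.corner e (i + 1)) : ℤ) : ℝ)
      = G.winding (L.pt j) - G.winding (L.pt (j + 1)) := by
    intro j hj
    rw [Finset.mem_range] at hj
    exact (G.winding_sub_winding (L.pt_notMem j hj.le) (L.pt_notMem (j + 1) hj)
      fun e i hi => (L.corner_notMem e i hi).1 j hj).symm
  have h3 := Finset.sum_congr rfl h2
  rw [Finset.sum_range_sub'] at h3
  rw [← sub_add_cancel (G.winding (L.pt 0)) (G.winding (L.pt L.size)), ← h3, h1,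
    ← Int.cast_sum, ← Int.cast_add]
  congr 1
  simp only [crossingNumber, Finset.sum_add_distrib]
  congr 1
  rw [Finset.sum_comm' (t' := Finset.univ) (s' := fun _ => Finset.range L.size) (by simp)]
  exact Finset.sum_congr rfl fun e _ => Finset.sum_comm

/-- The half-lines in the directions `1 + t i` meet only in `z`, so a finite set that omits `z`
cannot meet all of them. -/
theorem exists_direction_avoiding {z : ℂ} {F : Set ℂ} (hF : F.Finite) (hz : z ∉ F) :
    ∃ u : ℂ, u ≠ 0 ∧ ∀ x ∈ F, x ∉ halfLine z u := by
  have hinj : Function.Injective fun t : ℝ => (1 + t * Complex.I : ℂ) := by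
    intro s t h
    simpa using congrArg Complex.im h
  have hne : ∀ t : ℝ, (1 + t * Complex.I : ℂ) ≠ 0 := by
    intro t h
    simpa using congrArg Complex.re h
  by_contra hcon
  push Not at hcon
  choose g hg hg' using fun t : ℝ => hcon (1 + t * Complex.I) (hne t)
  have : Function.Injective g := by
    intro s t hst
    obtain ⟨a, ha, h1⟩ := hg' s
    obtain ⟨b, hb, h2⟩ := hg' t
    have h3 : (a : ℂ) * (1 + s * Complex.I) = b * (1 + t * Complex.I) := by
      rw [← hst, h1] at h2
      exact add_left_cancel h2
    have h4 : a = b := by simpa using congrArg Complex.re h3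
    have h5 : a * s = b * t := by simpa using congrArg Complex.im h3
    have h6 : a ≠ 0 := by
      rintro rfl
      exact hz (by have := hg s; rw [h1] at this; simpa using this)
    rw [← h4] at h5
    exact mul_left_cancel₀ h6 h5
  exact infinite_of_injective_forall_mem this hg hF

theorem nonempty_transverseLine [Finite V] (G : PlaneEulerianGraph V E) {C : Set ℂ} {z : ℂ}
    (hz : z ∉ G.support) (hzC : z ∈ C) : Nonempty (G.TransverseLine C) := by
  obtain ⟨u, hu, h⟩ := exists_direction_avoiding (z := z)
    (F := range G.pos ∪ ⋃ e, G.corner e '' Iic (G.size e))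
    ((finite_range _).union (finite_iUnion fun e => (finite_Iic _).image _)) (by
      rintro (h | h)
      · exact hz (Or.inl h)
      · obtain ⟨e, i, hi, rfl⟩ := mem_iUnion.1 h
        rcases Nat.lt_or_ge i (G.size e) with h' | h'
        · exact hz (G.segment_subset_support h' (left_mem_segment ℝ _ _))
        · rw [le_antisymm hi h', G.corner_size] at hz
          exact hz (Or.inl ⟨_, rfl⟩))
  refine ⟨⟨0, fun _ => z, u, hu, hzC, fun _ _ => hz, fun v => ⟨by simp, h _ (Or.inl ⟨v, rfl⟩)⟩,
    fun e i hi => ⟨by simp, h _ (Or.inr (mem_iUnion.2 ⟨e, i, hi, rfl⟩))⟩⟩⟩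

end PlaneEulerianGraph

/-! ### The jump of the winding number at a vertex. -/

theorem toIcoMod_arg_eq {x : ℂ} (hx : -x ∈ Complex.slitPlane) :
    toIcoMod Real.two_pi_pos 0 (Complex.arg x) = Complex.arg (-x) + Real.pi := by
  have h0 : x ≠ 0 := by
    rintro rfl
    simp at hx
  have h1 := Complex.neg_pi_lt_arg (-x)
  have h2 := lt_of_le_of_ne (Complex.arg_le_pi (-x)) (Complex.mem_slitPlane_iff_arg.1 hx).1
  refine (toIcoMod_eq_iff _).2 ⟨⟨by linarith, by linarith⟩, ?_⟩
  have h3 : ((Complex.arg x - (Complex.arg (-x) + Real.pi) : ℝ) : Real.Angle) = 0 := by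
    rw [Real.Angle.coe_sub, Real.Angle.coe_add, Complex.arg_neg_coe_angle h0, add_assoc,
      ← Real.Angle.coe_add, ← two_mul, Real.Angle.coe_two_pi, add_zero, sub_self]
  obtain ⟨n, hn⟩ := Real.Angle.coe_eq_zero_iff.1 h3
  exact ⟨n, by rw [hn]; ring⟩

theorem coe_ccwAngle {f d : ℂ} (hf : f ≠ 0) (hd : d ≠ 0) :
    (ccwAngle f d : Real.Angle) = d.arg - f.arg := by
  rw [ccwAngle, Real.Angle.coe_toIcoMod, Complex.arg_div_coe_angle hd hf]

/-- The two sides of a line through a point, in terms of the angle by which a ray in direction `d`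
is seen to turn when the point is crossed. -/
theorem left_or_right_of_mem_slitPlane {b f d : ℂ} (hb : -(d / b) ∈ Complex.slitPlane)
    (hf : -(d / f) ∈ Complex.slitPlane) :
    (IsLeftOf b f d ∧ Complex.arg (-(d / b)) - Complex.arg (-(d / f))
      = 2 * Real.pi - ccwAngle f b) ∨
    (IsRightOf b f d ∧ Complex.arg (-(d / b)) - Complex.arg (-(d / f)) = -ccwAngle f b) := by
  have hd0 : d ≠ 0 := by rintro rfl; simp at hb
  have hb0 : b ≠ 0 := by rintro rfl; simp at hb
  have hf0 : f ≠ 0 := by rintro rfl; simp at hf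
  have eA : ccwAngle b d = Complex.arg (-(d / b)) + Real.pi := toIcoMod_arg_eq hb
  have eD : ccwAngle f d = Complex.arg (-(d / f)) + Real.pi := toIcoMod_arg_eq hf
  have a1 := Complex.neg_pi_lt_arg (-(d / b))
  have a2 := lt_of_le_of_ne (Complex.arg_le_pi _) (Complex.mem_slitPlane_iff_arg.1 hb).1
  have d1 := Complex.neg_pi_lt_arg (-(d / f))
  have d2 := lt_of_le_of_ne (Complex.arg_le_pi _) (Complex.mem_slitPlane_iff_arg.1 hf).1
  obtain ⟨b1, b2⟩ : 0 ≤ ccwAngle f b ∧ ccwAngle f b < 0 + 2 * Real.pi :=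
    toIcoMod_mem_Ico Real.two_pi_pos 0 _
  have hpi := Real.pi_pos
  -- Turning from `f` to `b` and then to `d` agrees with turning from `f` to `d` modulo `2π`. The
  -- ranges of the angles allow only no excess (`d` on the right) or one full turn (`d` on the
  -- left).
  have h : ((ccwAngle b d - ccwAngle f d + ccwAngle f b : ℝ) : Real.Angle) = 0 := by
    rw [Real.Angle.coe_add, Real.Angle.coe_sub, coe_ccwAngle hb0 hd0, coe_ccwAngle hf0 hd0,
      coe_ccwAngle hf0 hb0]
    abel
  obtain ⟨n, hn⟩ := exists_int_of_angle_eq_zero h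
  have n0 : (-1 : ℝ) < n := by
    by_contra hh; push Not at hh; nlinarith
  have n1 : (n : ℝ) < 2 := by
    by_contra hh; push Not at hh; nlinarith
  have n0' : -1 < n := by exact_mod_cast n0
  have n1' : n < 2 := by exact_mod_cast n1
  unfold IsLeftOf IsRightOf
  obtain rfl | rfl : n = 0 ∨ n = 1 := by omega
  · right
    simp only [Int.cast_zero, mul_zero] at hn
    constructor <;> linarith
  · left
    simp only [Int.cast_one, mul_one] at hn
    refine ⟨⟨?_, ?_⟩, ?_⟩ <;> linarith

/-- From `v + ε b` the vertex is seen in direction `-b`, and `v + d` in a direction that tends to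
that of `d`. -/
theorem tendsto_viewAngle_vertex {d b : ℂ} (v : ℂ) (h : -(d / b) ∈ Complex.slitPlane) :
    Tendsto (fun ε : ℝ => viewAngle (v + ε * b) v (v + d)) (𝓝[>] 0)
      (𝓝 (Complex.arg (-(d / b)))) := by
  have hb0 : b ≠ 0 := by rintro rfl; simp at h
  have h1 : Tendsto (fun ε : ℝ => (d - ε * b) / (-b)) (𝓝[>] 0) (𝓝 (-(d / b))) := by
    refine tendsto_nhdsWithin_of_tendsto_nhds ?_
    have : Continuous fun ε : ℝ => (d - ε * b) / (-b) := by fun_prop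
    simpa [div_neg] using this.tendsto 0
  refine ((Complex.continuousAt_arg h).tendsto.comp h1).congr' ?_
  filter_upwards [self_mem_nhdsWithin] with ε hε
  have hε0 : (ε : ℂ) ≠ 0 := by exact_mod_cast (ne_of_gt hε)
  rw [Function.comp, viewAngle, ← Complex.arg_real_mul _ (inv_pos.2 hε)]
  congr 1
  push_cast
  rw [show v + d - (v + ε * b) = d - ε * b by ring, show v - (v + ε * b) = ε * (-b) by ring]
  field_simp

theorem neg_div_mem_slitPlane_of_avoids {s : Set ℂ} {v d b : ℂ} (hd : d ≠ 0) (hb : b ≠ 0)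
    (hs : segment ℝ v (v + d) ⊆ s) (h : ∀ t ∈ Ioo (0 : ℝ) 1, v + t * b ∉ s) :
    -(d / b) ∈ Complex.slitPlane := by
  by_contra hn
  rw [Complex.mem_slitPlane_iff, not_or, not_lt, not_not] at hn
  obtain ⟨r, hr⟩ : ∃ r : ℝ, r = (d / b).re := ⟨_, rfl⟩
  have hr0 : 0 ≤ r := by simpa [← hr] using hn.1
  have him : (d / b).im = 0 := by simpa using hn.2
  have hdb : d = r * b := by
    rw [← div_eq_iff hb]
    exact Complex.ext (by simp [hr]) (by simp [him])
  have hrne : r ≠ 0 := by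
    rintro rfl
    simp at hdb
    exact hd hdb
  have hrpos := lt_of_le_of_ne hr0 hrne.symm
  -- Here `d = r b` with `r > 0`, so the two germs overlap; this parameter gives a point on both.
  refine h (min r (1 / 2)) ⟨by positivity, (min_le_right _ _).trans_lt (by norm_num)⟩ (hs ?_)
  rw [segment_eq_image_lineMap]
  refine ⟨min r (1 / 2) / r, ⟨by positivity, (div_le_one hrpos).2 (min_le_left _ _)⟩, ?_⟩
  have : (r : ℂ) ≠ 0 := by exact_mod_cast hrne
  rw [AffineMap.lineMap_apply, hdb]
  simp
  field_simp
  ring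

namespace PlaneEulerianGraph

variable {V E : Type*} [Fintype E] [DecidableEq V]

open Classical in
/-- The number of links in `P` that leave `v` minus the number of those that point towards `v`. -/
noncomputable def netOut (G : PlaneEulerianGraph V E) (P : Set E) (v : V) : ℤ :=
  (∑ e, if G.src e = v then if e ∈ P then 1 else 0 else 0)
    - ∑ e, if G.tgt e = v then if e ∈ P then 1 else 0 else 0

theorem corner_succ_ne_pos (G : PlaneEulerianGraph V E) {e : E} {i : ℕ} (hi : i < G.size e) {v : V}
    (h0 : G.corner e i = G.pos v) : G.corner e (i + 1) ≠ G.pos v := by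
  intro h1
  refine G.ne_pos e i hi (1 / 2) ⟨by norm_num, by norm_num⟩ (Or.inr (by norm_num)) v ?_
  rw [h0, h1, AffineMap.lineMap_same_apply]

theorem pos_notMem_segment (G : PlaneEulerianGraph V E) {e : E} {i : ℕ} (hi : i < G.size e) {v : V}
    (h0 : ¬(i = 0 ∧ G.src e = v)) (h1 : ¬(i + 1 = G.size e ∧ G.tgt e = v)) :
    G.pos v ∉ segment ℝ (G.corner e i) (G.corner e (i + 1)) := by
  rw [segment_eq_image_lineMap]
  rintro ⟨s, hs, h⟩
  rcases eq_or_lt_of_le hs.2 with rfl | hs1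
  · rw [AffineMap.lineMap_apply_one] at h
    rcases Nat.lt_or_ge (i + 1) (G.size e) with h2 | h2
    · exact G.ne_pos e (i + 1) h2 0 ⟨le_rfl, one_pos⟩ (Or.inl i.succ_pos) v (by simpa using h)
    · have h3 : i + 1 = G.size e := le_antisymm hi h2
      rw [h3, G.corner_size] at h
      exact h1 ⟨h3, G.pos_injective h⟩
  · by_cases h2 : 0 < i ∨ 0 < s
    · exact G.ne_pos e i hi s ⟨hs.1, hs1⟩ h2 v h
    · obtain ⟨rfl, hs0⟩ : i = 0 ∧ s = 0 := by
        push Not at h2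
        exact ⟨by omega, le_antisymm h2.2 hs.1⟩
      rw [hs0, AffineMap.lineMap_apply_zero, G.corner_zero] at h
      exact h0 ⟨rfl, G.pos_injective h⟩

open Classical in
/-- Change of the view angle of a piece of a link along a line crossing the vertex `v`. -/
theorem tendsto_viewAngle_sub_viewAngle (G : PlaneEulerianGraph V E) {v : V} {b f : ℂ} {P : Set E}
    (hb0 : b ≠ 0) (hf0 : f ≠ 0)
    (hb : ∀ t ∈ Ioo (0 : ℝ) 1, G.pos v + t * b ∉ G.support)
    (hf : ∀ t ∈ Ioo (0 : ℝ) 1, G.pos v + t * f ∉ G.support)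
    (hout : ∀ e, G.src e = v → (IsLeftOf b f (G.corner e 1 - G.pos v) → e ∈ P) ∧
      (IsRightOf b f (G.corner e 1 - G.pos v) → e ∉ P))
    (hin : ∀ e, G.tgt e = v → (IsLeftOf b f (G.corner e (G.size e - 1) - G.pos v) → e ∈ P) ∧
      (IsRightOf b f (G.corner e (G.size e - 1) - G.pos v) → e ∉ P))
    (e : E) {i : ℕ} (hi : i < G.size e) :
    Tendsto (fun ε : ℝ => viewAngle (G.pos v + ε * b) (G.corner e i) (G.corner e (i + 1))
        - viewAngle (G.pos v + ε * f) (G.corner e i) (G.corner e (i + 1))) (𝓝[>] 0)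
      (𝓝 ((if i = 0 then if G.src e = v then
          (2 * Real.pi * (if e ∈ P then 1 else 0) - ccwAngle f b) else 0 else 0)
        - (if i = G.size e - 1 then if G.tgt e = v then
          (2 * Real.pi * (if e ∈ P then 1 else 0) - ccwAngle f b) else 0 else 0))) := by
  have hsub := G.segment_subset_support hi
  have key : ∀ d : ℂ, d ≠ 0 → segment ℝ (G.pos v) (G.pos v + d) ⊆ G.support →
      (IsLeftOf b f d → e ∈ P) ∧ (IsRightOf b f d → e ∉ P) →
      Tendsto (fun ε : ℝ => viewAngle (G.pos v + ε * b) (G.pos v) (G.pos v + d)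
        - viewAngle (G.pos v + ε * f) (G.pos v) (G.pos v + d)) (𝓝[>] 0)
        (𝓝 (2 * Real.pi * (if e ∈ P then 1 else 0) - ccwAngle f b)) := by
    intro d hd hsd hP
    have sb := neg_div_mem_slitPlane_of_avoids hd hb0 hsd hb
    have sf := neg_div_mem_slitPlane_of_avoids hd hf0 hsd hf
    have ht := (tendsto_viewAngle_vertex (G.pos v) sb).sub (tendsto_viewAngle_vertex (G.pos v) sf)
    rcases left_or_right_of_mem_slitPlane sb sf with ⟨h1, h2⟩ | ⟨h1, h2⟩
    · rw [h2] at ht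
      rw [if_pos (hP.1 h1), mul_one]
      exact ht
    · rw [h2] at ht
      rw [if_neg (hP.2 h1), mul_zero, zero_sub]
      exact ht
  by_cases h0 : i = 0 ∧ G.src e = v
  · obtain ⟨rfl, hv⟩ := h0
    have hc0 : G.corner e 0 = G.pos v := by rw [G.corner_zero, hv]
    have hc1 := G.corner_succ_ne_pos hi hc0
    have hnot : ¬(0 = G.size e - 1 ∧ G.tgt e = v) := by
      rintro ⟨h1, h2⟩
      apply hc1
      rw [show 0 + 1 = G.size e by omega, G.corner_size, h2]
    have hz : (if 0 = G.size e - 1 then if G.tgt e = v then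
        (2 * Real.pi * (if e ∈ P then 1 else 0) - ccwAngle f b) else 0 else 0) = 0 := by
      rw [← ite_and, if_neg hnot]
    rw [hz, if_pos rfl, if_pos hv, sub_zero, hc0]
    have := key (G.corner e 1 - G.pos v) (sub_ne_zero.2 hc1)
      (by rw [add_sub_cancel]; rwa [hc0] at hsub) (hout e hv)
    rwa [add_sub_cancel] at this
  have hz0 : (if i = 0 then if G.src e = v then
        (2 * Real.pi * (if e ∈ P then 1 else 0) - ccwAngle f b) else 0 else 0) = 0 := by
      rw [← ite_and, if_neg h0]
  rw [hz0]
  by_cases h1 : i + 1 = G.size e ∧ G.tgt e = v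
  · obtain ⟨h1, hv⟩ := h1
    have hi' : i = G.size e - 1 := by omega
    have hc1 : G.corner e (i + 1) = G.pos v := by rw [h1, G.corner_size, hv]
    have hc0 : G.corner e i ≠ G.pos v := fun h => G.corner_succ_ne_pos hi h hc1
    rw [if_pos hi', if_pos hv, zero_sub, hc1]
    have := key (G.corner e i - G.pos v) (sub_ne_zero.2 hc0)
      (by rw [add_sub_cancel]; rwa [hc1, segment_symm] at hsub) (by rw [hi']; exact hin e hv)
    rw [add_sub_cancel] at this
    -- An incoming piece ends at `v`, so its angle is reversed; this changes the sign only off the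
    -- segment, hence the restriction to small `ε`.
    refine this.neg.congr' ?_
    filter_upwards [Ioo_mem_nhdsGT (zero_lt_one' ℝ)] with ε hε
    rw [hc1] at hsub
    rw [viewAngle_swap (a := G.corner e i) (b := G.pos v) fun h => hb ε hε (hsub h),
      viewAngle_swap (a := G.corner e i) (b := G.pos v) fun h => hf ε hε (hsub h)]
    ring
  · have hz1 : (if i = G.size e - 1 then if G.tgt e = v then
        (2 * Real.pi * (if e ∈ P then 1 else 0) - ccwAngle f b) else 0 else 0) = 0 := by
      rw [← ite_and, if_neg fun h => h1 ⟨by omega, h.2⟩]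
    rw [hz1]
    have hv := G.pos_notMem_segment hi h0 h1
    have hcont : ∀ u : ℂ, Tendsto (fun ε : ℝ =>
        viewAngle (G.pos v + ε * u) (G.corner e i) (G.corner e (i + 1))) (𝓝[>] 0)
        (𝓝 (viewAngle (G.pos v) (G.corner e i) (G.corner e (i + 1)))) := by
      intro u
      have hl : Continuous fun ε : ℝ => G.pos v + ε * u := by fun_prop
      have := (hl.continuousAt (x := 0)).viewAngle (continuousAt_const (y := G.corner e i))
        (continuousAt_const (y := G.corner e (i + 1))) (by simpa using hv)
      simpa using this.tendsto.mono_left nhdsWithin_le_nhds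
    simpa using (hcont b).sub (hcont f)

/-- With `β = ccwAngle f b`, an outgoing link jumps by `2π - β` on the left and by `-β` on the
right; incoming links jump by the opposite amounts. Balance at `v` removes `β`. -/
theorem tendsto_winding_sub_winding (G : PlaneEulerianGraph V E) {v : V} {b f : ℂ} {P : Set E}
    (hb0 : b ≠ 0) (hf0 : f ≠ 0)
    (hb : ∀ t ∈ Ioo (0 : ℝ) 1, G.pos v + t * b ∉ G.support)
    (hf : ∀ t ∈ Ioo (0 : ℝ) 1, G.pos v + t * f ∉ G.support)
    (hout : ∀ e, G.src e = v → (IsLeftOf b f (G.corner e 1 - G.pos v) → e ∈ P) ∧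
      (IsRightOf b f (G.corner e 1 - G.pos v) → e ∉ P))
    (hin : ∀ e, G.tgt e = v → (IsLeftOf b f (G.corner e (G.size e - 1) - G.pos v) → e ∈ P) ∧
      (IsRightOf b f (G.corner e (G.size e - 1) - G.pos v) → e ∉ P)) :
    Tendsto (fun ε : ℝ => G.winding (G.pos v + ε * b) - G.winding (G.pos v + ε * f)) (𝓝[>] 0)
      (𝓝 (G.netOut P v)) := by
  classical
  have h := (tendsto_finsetSum Finset.univ fun e _ => tendsto_finsetSum (Finset.range (G.size e))
    fun i hi => G.tendsto_viewAngle_sub_viewAngle hb0 hf0 hb hf hout hin e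
      (Finset.mem_range.1 hi)).div_const (2 * Real.pi)
  have hβ := G.sum_tgt_eq_sum_src fun w => if w = v then ccwAngle f b else 0
  have hpi := Real.pi_pos
  convert h using 2 with ε
  · simp only [winding, Finset.sum_sub_distrib, sub_div]
  · rw [eq_div_iff (by positivity)]
    have hs : ∀ e, (∑ i ∈ Finset.range (G.size e), ((if i = 0 then if G.src e = v then
          (2 * Real.pi * (if e ∈ P then 1 else 0) - ccwAngle f b) else 0 else 0)
        - (if i = G.size e - 1 then if G.tgt e = v then
          (2 * Real.pi * (if e ∈ P then 1 else 0) - ccwAngle f b) else 0 else 0)))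
        = (2 * Real.pi * (if G.src e = v then if e ∈ P then 1 else 0 else 0)
          - (if G.src e = v then ccwAngle f b else 0))
        - (2 * Real.pi * (if G.tgt e = v then if e ∈ P then 1 else 0 else 0)
          - (if G.tgt e = v then ccwAngle f b else 0)) := by
      intro e
      have h1 := G.size_pos e
      rw [Finset.sum_sub_distrib, Finset.sum_ite_eq', Finset.sum_ite_eq',
        if_pos (Finset.mem_range.2 h1), if_pos (Finset.mem_range.2 (by omega))]
      split_ifs <;> ring
    rw [Finset.sum_congr rfl fun e _ => hs e]
    simp only [Finset.sum_sub_distrib, ← Finset.mul_sum, hβ, netOut]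
    push_cast
    ring

end PlaneEulerianGraph

/-! ### The flow as a sum over vertices. -/

namespace PlaneEulerianGraph

variable {V E : Type*} [Fintype E] [DecidableEq V] [DecidableEq E]

namespace Scattering

variable {G : PlaneEulerianGraph V E}

theorem evolution_of_tgt_eq (S : G.Scattering) {v : V} {e' e : E} (he : G.tgt e = v)
    (he' : G.src e' = v) : S.evolution e' e = S.amp v ⟨e', he'⟩ ⟨e, he⟩ := by
  subst he
  rw [evolution, dif_pos he']

theorem evolution_eq_zero (S : G.Scattering) {e' e : E} (h : G.src e' ≠ G.tgt e) :
    S.evolution e' e = 0 := dif_neg h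

/-- The row of a link is supported on the links entering its source. Rows with different sources
have disjoint supports; the others are rows of one scattering matrix. -/
theorem evolution_mul_conjTranspose (S : G.Scattering) :
    S.evolution * S.evolution.conjTranspose = 1 := by
  ext a b
  simp only [Matrix.mul_apply, Matrix.conjTranspose_apply]
  by_cases hab : G.src a = G.src b
  · have h := congrFun (congrFun (S.mul_conjTranspose (G.src b)) ⟨a, hab⟩) ⟨b, rfl⟩
    simp only [Matrix.mul_apply, Matrix.conjTranspose_apply, Matrix.one_apply,
      Subtype.mk.injEq] at h
    rw [Matrix.one_apply, ← h, ← Finset.sum_filter_add_sum_filter_not Finset.univ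
      (fun e => G.tgt e = G.src b), Finset.sum_eq_zero (s := Finset.filter (fun e => ¬ _) _),
      add_zero, Finset.sum_subtype (p := fun e => G.tgt e = G.src b) _ (by simp)]
    · refine Finset.sum_congr rfl fun e _ => ?_
      rw [S.evolution_of_tgt_eq e.2 hab, S.evolution_of_tgt_eq e.2 rfl]
    · intro e he
      rw [S.evolution_eq_zero fun h' => (Finset.mem_filter.1 he).2 (h' ▸ hab), zero_mul]
  · rw [Matrix.one_apply_ne fun h => hab (congrArg G.src h)]
    refine Finset.sum_eq_zero fun e _ => ?_
    by_cases h : G.src a = G.tgt e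
    · rw [S.evolution_eq_zero (e' := b) fun h' => hab (h.trans h'.symm), star_zero, mul_zero]
    · rw [S.evolution_eq_zero h, zero_mul]

theorem conjTranspose_mul_evolution (S : G.Scattering) :
    S.evolution.conjTranspose * S.evolution = 1 :=
  mul_eq_one_comm.1 S.evolution_mul_conjTranspose

open Classical in
theorem flow_eq_sum (S : G.Scattering) (P Q : Set E) :
    S.flow P Q = ∑ e, if e ∈ Q then
      (∑ e', if e' ∈ P then star (S.evolution e' e) * S.evolution e' e else 0)
        - (if e ∈ P then 1 else 0) else 0 := by
  rw [flow, flowOperator, Matrix.inv_eq_left_inv S.conjTranspose_mul_evolution, Matrix.trace]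
  refine Finset.sum_congr rfl fun e _ => ?_
  simp only [Matrix.diag_apply, Matrix.sub_apply, projector, Matrix.mul_diagonal,
    Matrix.diagonal_mul, Matrix.mul_apply (M := _ * _ * _) (N := S.evolution),
    Matrix.conjTranspose_apply, Matrix.diagonal_apply_eq]
  by_cases hQ : e ∈ Q
  · simp [hQ, ite_mul]
  · simp [hQ]

theorem sum_star_mul_evolution (S : G.Scattering) (e : E) :
    ∑ e', star (S.evolution e' e) * S.evolution e' e = 1 := by
  simpa [Matrix.mul_apply] using congrFun (congrFun S.conjTranspose_mul_evolution e) e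

theorem sum_tgt_star_mul_evolution (S : G.Scattering) (e' : E) (v : V) :
    (∑ e, if G.tgt e = v then star (S.evolution e' e) * S.evolution e' e else 0)
      = if G.src e' = v then 1 else 0 := by
  split_ifs with h
  · have h1 : ∑ e, S.evolution e' e * star (S.evolution e' e) = 1 := by
      simpa [Matrix.mul_apply] using congrFun (congrFun S.evolution_mul_conjTranspose e') e'
    rw [← h1]
    refine Finset.sum_congr rfl fun e _ => ?_
    split_ifs with h2
    · rw [mul_comm]
    · rw [S.evolution_eq_zero fun h3 => h2 (h3.symm.trans h), zero_mul]
  · refine Finset.sum_eq_zero fun e _ => ?_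
    split_ifs with h2
    · rw [S.evolution_eq_zero fun h3 => h (h3.trans h2), mul_zero]
    · rfl

open Classical in
-- After exchanging the sums, each link of `P` leaving `v` collects total probability `1` from the
-- links entering `v`, since the rows of the scattering matrix are normalised.
theorem sum_tgt_sub (S : G.Scattering) (P : Set E) (v : V) :
    (∑ e, if G.tgt e = v then
      (∑ e', if e' ∈ P then star (S.evolution e' e) * S.evolution e' e else 0)
        - (if e ∈ P then 1 else 0) else 0) = (G.netOut P v : ℂ) := by
  have h : ∀ e, (if G.tgt e = v then
      (∑ e', if e' ∈ P then star (S.evolution e' e) * S.evolution e' e else 0)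
        - (if e ∈ P then 1 else 0) else 0)
      = (∑ e', if e' ∈ P then if G.tgt e = v then
          star (S.evolution e' e) * S.evolution e' e else 0 else 0)
        - if G.tgt e = v then if e ∈ P then 1 else 0 else 0 := by
    intro e
    split_ifs <;> simp
  rw [Finset.sum_congr rfl fun e _ => h e, Finset.sum_sub_distrib, Finset.sum_comm, netOut]
  push_cast
  congr 1
  refine Finset.sum_congr rfl fun e' _ => ?_
  by_cases hP : e' ∈ P
  · simp only [hP, if_true]
    exact S.sum_tgt_star_mul_evolution e' v
  · simp [hP]

/-- A link pointing towards a vertex all of whose links are on the same side of `P` does not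
contribute to the flow. -/
theorem contribution_eq_zero (S : G.Scattering) {P : Set E} {e : E} [DecidablePred (· ∈ P)]
    (h : (∀ e₁, (G.src e₁ = G.tgt e ∨ G.tgt e₁ = G.tgt e) → e₁ ∉ P) ∨
      (∀ e₂, (G.src e₂ = G.tgt e ∨ G.tgt e₂ = G.tgt e) → e₂ ∈ P)) :
    (∑ e', if e' ∈ P then star (S.evolution e' e) * S.evolution e' e else 0)
      - (if e ∈ P then 1 else 0) = 0 := by
  rcases h with h | h
  · rw [if_neg (h e (Or.inr rfl)), sub_zero]
    refine Finset.sum_eq_zero fun e' _ => ?_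
    split_ifs with h'
    · rw [S.evolution_eq_zero fun h'' => h e' (Or.inl h'') h', mul_zero]
    · rfl
  · rw [if_pos (h e (Or.inr rfl)), ← S.sum_star_mul_evolution e, sub_eq_zero]
    refine Finset.sum_congr rfl fun e' _ => ?_
    split_ifs with h'
    · rfl
    · rw [S.evolution_eq_zero fun h'' => h' (h e' (Or.inl h'')), mul_zero]

open Classical in
-- Group the links of `Q` by target. Off the section, `SinglesOut` leaves in `Q` only links towards
-- vertices whose links are all inside or all outside `R`, and these contribute zero.
theorem flow_eq_sum_netOut [Fintype V] (S : G.Scattering) {C : Set ℂ} {σ : G.CrossSection C}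
    {R : Set ℂ} {Q : Set E} (hQ : G.SinglesOut σ R Q) :
    S.flow (G.linksIn R) Q
      = ((∑ v, if v ∈ σ.vertices then G.netOut (G.linksIn R) v else 0 : ℤ) : ℂ) := by
  rw [flow_eq_sum]
  push_cast
  have h : ∀ v, (if v ∈ σ.vertices then (G.netOut (G.linksIn R) v : ℂ) else 0)
      = ∑ e, if G.tgt e = v then if v ∈ σ.vertices then
        (∑ e', if e' ∈ G.linksIn R then star (S.evolution e' e) * S.evolution e' e else 0)
        - (if e ∈ G.linksIn R then 1 else 0) else 0 else 0 := by
    intro v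
    split_ifs with hv
    · exact (S.sum_tgt_sub _ v).symm
    · simp
  rw [Finset.sum_congr rfl fun v _ => h v, Finset.sum_comm]
  refine Finset.sum_congr rfl fun e _ => ?_
  rw [Finset.sum_ite_eq, if_pos (Finset.mem_univ _)]
  by_cases hv : G.tgt e ∈ σ.vertices
  · rw [if_pos hv, if_pos (hQ.mem e hv)]
  · rw [if_neg hv]
    by_cases hq : e ∈ Q
    · rw [if_pos hq]
      refine S.contribution_eq_zero (P := G.linksIn R) ?_
      by_contra hcon
      push Not at hcon
      exact hQ.notMem e hv hcon.1 hcon.2 hq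
    · rw [if_neg hq]

end Scattering

end PlaneEulerianGraph

/-! ### The winding number along a cross section. -/

namespace PlaneEulerianGraph

variable {V E : Type*} [Fintype E] [DecidableEq V]

theorem pos_add_mem_linkInterior_of_src (G : PlaneEulerianGraph V E) {e : E} {v : V}
    (h : G.src e = v) {t : ℝ} (ht : t ∈ Ioo (0 : ℝ) 1) :
    G.pos v + t * (G.corner e 1 - G.pos v) ∈ G.linkInterior e := by
  refine ⟨0, G.size_pos e, t, ⟨ht.1.le, ht.2⟩, Or.inr ht.1, ?_⟩
  rw [AffineMap.lineMap_apply, G.corner_zero, h]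
  simp [add_comm]

theorem pos_add_mem_linkInterior_of_tgt (G : PlaneEulerianGraph V E) {e : E} {v : V}
    (h : G.tgt e = v) {t : ℝ} (ht : t ∈ Ioo (0 : ℝ) 1) :
    G.pos v + t * (G.corner e (G.size e - 1) - G.pos v) ∈ G.linkInterior e := by
  have h1 := G.size_pos e
  refine ⟨G.size e - 1, by omega, 1 - t, ⟨by linarith [ht.2], by linarith [ht.1]⟩,
    Or.inr (by linarith [ht.2]), ?_⟩
  rw [AffineMap.lineMap_apply, Nat.sub_add_cancel h1, G.corner_size, h]
  simp
  ring

/-- A link lies wholly inside `R` or wholly outside, so one point of its germ at `v` decides. -/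
theorem IsAnticlockwiseSide.link_side_of_germ {G : PlaneEulerianGraph V E} {C R : Set ℂ}
    {σ : G.CrossSection C} (hR : G.IsAnticlockwiseSide σ R) {i : ℕ} (hi : i + 1 < σ.size) {v : V}
    (hv : σ.pt (i + 1) = G.pos v) {e : E} {d : ℂ}
    (hd : ∀ t ∈ Ioo (0 : ℝ) 1, G.pos v + t * d ∈ G.linkInterior e) :
    (IsLeftOf (σ.pt i - σ.pt (i + 1)) (σ.pt (i + 2) - σ.pt (i + 1)) d → e ∈ G.linksIn R) ∧
    (IsRightOf (σ.pt i - σ.pt (i + 1)) (σ.pt (i + 2) - σ.pt (i + 1)) d → e ∉ G.linksIn R) := by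
  have h01 := Ioo_mem_nhdsGT (zero_lt_one' ℝ)
  constructor
  · intro h
    obtain ⟨t, ht, ht'⟩ := ((hR.left_mem i hi v hv d h).and h01).exists
    exact (hR.link_side e).resolve_right fun hdis => hdis.notMem_of_mem_left (hd t ht') ht
  · intro h he
    obtain ⟨t, ht, ht'⟩ := ((hR.right_notMem i hi v hv d h).and h01).exists
    exact ht (he (hd t ht'))

namespace CrossSection

variable {G : PlaneEulerianGraph V E} {C : Set ℂ}

theorem winding_lineMap_eq (G : PlaneEulerianGraph V E) {p q : ℂ} {I : Set ℝ}
    (hI : IsPreconnected I) (h : ∀ s ∈ I, (AffineMap.lineMap p q s : ℂ) ∉ G.support) {s t : ℝ}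
    (hs : s ∈ I) (ht : t ∈ I) :
    G.winding (AffineMap.lineMap p q s) = G.winding (AffineMap.lineMap p q t) := by
  refine G.winding_eq_of_isPreconnected
    (hI.image _ (AffineMap.lineMap_continuous (p := p) (q := q)).continuousOn) ?_
    ⟨s, hs, rfl⟩ ⟨t, ht, rfl⟩
  rintro _ ⟨r, hr, rfl⟩
  exact h r hr

/-- The winding number of the graph around the points of a segment of the section. -/
noncomputable def windingAt (σ : G.CrossSection C) (i : ℕ) : ℝ :=
  G.winding (AffineMap.lineMap (σ.pt i) (σ.pt (i + 1)) (1 / 2 : ℝ))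

theorem winding_eq_windingAt (σ : G.CrossSection C) {i : ℕ} (hi : i < σ.size) {s : ℝ}
    (hs : s ∈ Ioo (0 : ℝ) 1) :
    G.winding (AffineMap.lineMap (σ.pt i) (σ.pt (i + 1)) s) = σ.windingAt i :=
  winding_lineMap_eq G isPreconnected_Ioo (σ.avoids_links i hi) hs (by constructor <;> norm_num)

theorem winding_left_eq_windingAt (σ : G.CrossSection C) {i : ℕ} (hi : i < σ.size)
    (h : σ.pt i ∉ G.support) : G.winding (σ.pt i) = σ.windingAt i := by
  rw [← AffineMap.lineMap_apply_zero (k := ℝ) (σ.pt i) (σ.pt (i + 1))]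
  refine winding_lineMap_eq G (isPreconnected_Ico (a := (0 : ℝ)) (b := 1)) (fun s hs => ?_)
    (by simp) (by constructor <;> norm_num)
  rcases eq_or_lt_of_le hs.1 with rfl | h0
  · simpa using h
  · exact σ.avoids_links i hi s ⟨h0, hs.2⟩

theorem winding_right_eq_windingAt (σ : G.CrossSection C) {i : ℕ} (hi : i < σ.size)
    (h : σ.pt (i + 1) ∉ G.support) : G.winding (σ.pt (i + 1)) = σ.windingAt i := by
  rw [← AffineMap.lineMap_apply_one (k := ℝ) (σ.pt i) (σ.pt (i + 1))]
  refine winding_lineMap_eq G (isPreconnected_Ioc (a := (0 : ℝ)) (b := 1)) (fun s hs => ?_)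
    (by simp) (by constructor <;> norm_num)
  rcases eq_or_lt_of_le hs.2 with rfl | h1
  · simpa using h
  · exact σ.avoids_links i hi s ⟨hs.1, h1⟩

theorem pt_succ_ne (σ : G.CrossSection C) {i : ℕ} (hi : i < σ.size) : σ.pt (i + 1) ≠ σ.pt i := by
  intro h
  have := σ.simple i hi i hi 0 (by simp) 1 (by simp) (by simp [h])
  simp at this

theorem pt_succ_injective (σ : G.CrossSection C) {i j : ℕ} (hi : i < σ.size) (hj : j < σ.size)
    (h : σ.pt (i + 1) = σ.pt (j + 1)) : i = j := by
  have := σ.simple i hi j hj 1 (by simp) 1 (by simp) (by simp [h])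
  simpa using this

/-- Both ends of the section are off the graph, so only the intermediate points `pt 1, …, pt (size -
1)` can be vertices. -/
theorem mem_vertices_iff (σ : G.CrossSection C) (h0 : σ.pt 0 ∉ G.support) {v : V} :
    v ∈ σ.vertices ↔ ∃ i ∈ Finset.range (σ.size - 1), σ.pt (i + 1) = G.pos v := by
  constructor
  · rintro ⟨i, hi, h⟩
    have hv : G.pos v ∈ G.support := Or.inl ⟨v, rfl⟩
    have hi0 : i ≠ 0 := by
      rintro rfl
      exact h0 (h ▸ hv)
    have hi1 : i ≠ σ.size := by
      rintro rfl
      exact G.exterior_subset σ.end_mem (h ▸ hv)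
    exact ⟨i - 1, Finset.mem_range.2 (by omega), by rwa [Nat.sub_add_cancel (by omega)]⟩
  · rintro ⟨i, hi, h⟩
    exact ⟨i + 1, by have := Finset.mem_range.1 hi; omega, h⟩

open Classical in
theorem windingAt_sub_windingAt [Fintype V] (σ : G.CrossSection C) {R : Set ℂ}
    (hR : G.IsAnticlockwiseSide σ R) {i : ℕ} (hi : i + 1 < σ.size) :
    σ.windingAt i - σ.windingAt (i + 1)
      = ((∑ v, if σ.pt (i + 1) = G.pos v then G.netOut (G.linksIn R) v else 0 : ℤ) : ℝ) := by
  by_cases hs : σ.pt (i + 1) ∈ G.support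
  swap
  · rw [← σ.winding_right_eq_windingAt (by omega) hs, ← σ.winding_left_eq_windingAt hi hs, sub_self,
      Finset.sum_eq_zero fun v _ => if_neg fun h : σ.pt (i + 1) = G.pos v =>
        hs (h ▸ Or.inl ⟨v, rfl⟩), Int.cast_zero]
  obtain ⟨v, hv⟩ := σ.crosses_vertices (i + 1) hi.le hs
  have hsum : (∑ w, if σ.pt (i + 1) = G.pos w then G.netOut (G.linksIn R) w else 0)
      = G.netOut (G.linksIn R) v := by
    rw [← hv]
    simp only [G.pos_injective.eq_iff, Finset.sum_ite_eq, Finset.mem_univ, if_true]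
  rw [hsum]
  have hb : ∀ t : ℝ, G.pos v + t * (σ.pt i - σ.pt (i + 1))
      = AffineMap.lineMap (σ.pt i) (σ.pt (i + 1)) (1 - t) := by
    intro t
    rw [AffineMap.lineMap_apply, hv]
    simp
    ring
  have hf : ∀ t : ℝ, G.pos v + t * (σ.pt (i + 2) - σ.pt (i + 1))
      = AffineMap.lineMap (σ.pt (i + 1)) (σ.pt (i + 1 + 1)) t := by
    intro t
    rw [AffineMap.lineMap_apply, hv]
    simp only [vsub_eq_sub, vadd_eq_add, Complex.real_smul]
    rw [add_comm]
  have h1 : ∀ t ∈ Ioo (0 : ℝ) 1, 1 - t ∈ Ioo (0 : ℝ) 1 := fun t ht =>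
    ⟨by linarith [ht.2], by linarith [ht.1]⟩
  have ht := G.tendsto_winding_sub_winding (v := v) (P := G.linksIn R)
    (b := σ.pt i - σ.pt (i + 1)) (f := σ.pt (i + 2) - σ.pt (i + 1))
    (sub_ne_zero.2 (σ.pt_succ_ne (by omega)).symm) (sub_ne_zero.2 (σ.pt_succ_ne hi))
    (fun t ht => by rw [hb]; exact σ.avoids_links i (by omega) _ (h1 t ht))
    (fun t ht => by rw [hf]; exact σ.avoids_links (i + 1) hi t ht)
    (fun e he => hR.link_side_of_germ hi hv.symm
      fun t ht => G.pos_add_mem_linkInterior_of_src he ht)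
    (fun e he => hR.link_side_of_germ hi hv.symm
      fun t ht => G.pos_add_mem_linkInterior_of_tgt he ht)
  -- The difference of winding numbers is constant in `t` on `(0, 1)`, so it equals its limit at the
  -- vertex.
  refine tendsto_nhds_unique (tendsto_const_nhds.congr' ?_) ht
  filter_upwards [Ioo_mem_nhdsGT (zero_lt_one' ℝ)] with t ht
  rw [hb, hf, σ.winding_eq_windingAt (by omega) (h1 t ht), σ.winding_eq_windingAt hi ht]

open Classical in
-- The jumps telescope from `C` to the exterior; as the section is simple, each of its vertices is
-- counted once.
theorem winding_eq_sum_netOut [Fintype V] (σ : G.CrossSection C) {R : Set ℂ}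
    (hR : G.IsAnticlockwiseSide σ R) (h0 : σ.pt 0 ∉ G.support) :
    G.winding (σ.pt 0)
      = ((∑ v, if v ∈ σ.vertices then G.netOut (G.linksIn R) v else 0 : ℤ) : ℝ) := by
  have hv : ∀ v, (if v ∈ σ.vertices then G.netOut (G.linksIn R) v else 0)
      = ∑ i ∈ Finset.range (σ.size - 1),
        if σ.pt (i + 1) = G.pos v then G.netOut (G.linksIn R) v else 0 := by
    intro v
    split_ifs with h
    · obtain ⟨i, hi, hiv⟩ := (σ.mem_vertices_iff h0).1 h
      rw [Finset.sum_eq_single_of_mem i hi, if_pos hiv]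
      intro j hj hji
      rw [Finset.mem_range] at hi hj
      exact if_neg fun hjv => hji (σ.pt_succ_injective (by omega) (by omega) (hjv.trans hiv.symm))
    · exact (Finset.sum_eq_zero fun i hi => if_neg fun hiv =>
        h ((σ.mem_vertices_iff h0).2 ⟨i, hi, hiv⟩)).symm
  rw [Finset.sum_congr rfl fun v _ => hv v, Finset.sum_comm, Int.cast_sum,
    ← Finset.sum_congr rfl fun i hi => σ.windingAt_sub_windingAt hR
      (show i + 1 < σ.size by have := Finset.mem_range.1 hi; omega),
    Finset.sum_range_sub']
  have hend := G.winding_eq_zero_of_mem_exterior σ.end_mem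
  -- If `size = 0`, then `size - 1` is `0`, there is no jump, and the starting point is itself in
  -- the exterior.
  rcases Nat.eq_zero_or_pos σ.size with h | h
  · rw [h] at hend ⊢
    rw [hend, Nat.zero_sub, sub_self]
  · have := σ.winding_right_eq_windingAt (i := σ.size - 1) (by omega)
      (by rw [Nat.sub_add_cancel h]; exact G.exterior_subset σ.end_mem)
    rw [Nat.sub_add_cancel h, hend] at this
    rw [← this, sub_zero, σ.winding_left_eq_windingAt h h0]

end CrossSection

end PlaneEulerianGraph

theorem mainTheorem5 {V E : Type*} [Fintype V] [DecidableEq V] [Fintype E] [DecidableEq E]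
    (I : PlaneEulerianGraph V E) (C : Set ℂ) (hC : I.IsFace C) :
    ∃ W : ℤ, I.IsWindingNumber C W ∧
      ∀ (S : I.Scattering) (σ : I.CrossSection C) (R : Set ℂ) (Q : Set E),
        I.IsAnticlockwiseSide σ R → I.SinglesOut σ R Q →
        S.flow (I.linksIn R) Q = (W : ℂ) := by
  obtain ⟨z, hz, rfl⟩ := hC
  obtain ⟨W, hW⟩ := I.exists_int_winding hz
  have hface : ∀ x ∈ connectedComponentIn I.supportᶜ z, I.winding x = W := fun x hx => by
    rw [← hW]
    exact I.winding_eq_of_isPreconnected isPreconnected_connectedComponentIn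
      (connectedComponentIn_subset _ _) hx (mem_connectedComponentIn hz)
  refine ⟨W, ⟨I.nonempty_transverseLine hz (mem_connectedComponentIn hz), fun L => ?_⟩, ?_⟩
  · have h := I.crossingNumber_eq_winding L
    rw [hface _ L.start_mem] at h
    exact_mod_cast h
  · intro S σ R Q hR hQ
    have h := σ.winding_eq_sum_netOut hR (connectedComponentIn_subset _ _ σ.start_mem)
    rw [hface _ σ.start_mem] at h
    rw [S.flow_eq_sum_netOut hQ, Int.cast_injective h]
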